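/- Theorem 1.3. There are absolute constants $0<c\le C$ such that the following holds for all positive integers $m$ and $t$ with $m$ even and $4t^2\le m$. Let $G_{m,t}$ be the graph on the $n=2^m$ vertices $\{0,1\}^m$ in which two vectors are adjacent if and only if their Hamming distance exceeds $m-2t$. Then the independence number of $G_{m,t}$ is $$\alpha(G_{m,t})=\sum_{i=0}^{m/2-t}\binom{m}{i},$$ and the minimum cardinality $h(G_{m,t})$ of a set of vertices that intersects every maximum independent set of $G_{m,t}$ (every independent set of size $\alpha(G_{m,t})$) satisfies $c\,t^2\le h(G_{m,t})\le C\,t^2$. -/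

import Mathlib

open Finset

/-- The graph on `{0,1}^m` (vertices: all binary vectors of length `m`) in which two vectors are
adjacent iff their Hamming distance exceeds `m - 2 t`.  It is only used for `2 t ≤ m`, where the
subtraction is exact. -/
def farGraph (m t : ℕ) : SimpleGraph (Fin m → Bool) where
  Adj x y := m - 2 * t < hammingDist x y
  symm := ⟨fun x y h => by rwa [hammingDist_comm]⟩
  loopless := ⟨fun x h => by simp at h⟩

/-- `S` meets every maximum independent set of `G`
(every independent set whose cardinality is the independence number). -/
def HitsMaxIndepSets {V : Type*} [Fintype V] [DecidableEq V] (G : SimpleGraph V)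
    (S : Finset V) : Prop :=
  ∀ I : Finset V, G.IsMaximumIndepSet I → (S ∩ I).Nonempty

/-- `h(G)`: the minimum cardinality of a vertex set meeting every maximum independent set of `G`. -/
noncomputable def hittingNumber {V : Type*} [Fintype V] [DecidableEq V] (G : SimpleGraph V) : ℕ :=
  sInf {k | ∃ S : Finset V, S.card = k ∧ HitsMaxIndepSets G S}

/-- On a nonempty vertex set the minimum in `hittingNumber` is attained. -/
theorem exists_card_eq_hittingNumber {V : Type*} [Fintype V] [DecidableEq V] [Nonempty V]
    (G : SimpleGraph V) :
    ∃ S : Finset V, S.card = hittingNumber G ∧ HitsMaxIndepSets G S := by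
  have hne : {k | ∃ S : Finset V, S.card = k ∧ HitsMaxIndepSets G S}.Nonempty := by
    refine ⟨_, univ, rfl, fun I hI => ?_⟩
    rw [univ_inter]
    obtain ⟨v⟩ := ‹Nonempty V›
    have h1 : ({v} : Finset V).card ≤ I.card := hI.maximum {v} (by simp)
    exact card_pos.mp (by simpa using h1)
  exact Nat.sInf_mem hne

/-!
Why the theorem holds. Write `d = m / 2 - t`, so that `m - 2 t = 2 d` and the independent sets of
`farGraph m t` are the sets of binary vectors of diameter at most `2 d`.

*The maximum independent sets are the Hamming balls of radius `d`.* This is Kleitman's diameter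
theorem with its equality case, `card_le_of_card_symmDiff_le`. Down-compressions turn a family of
small diameter into a down-set, in which all pairwise unions have size at most `2 d`; for such
families `card_le_of_card_union_le` shifts one point `a` away and inducts on the ground set, the
members containing `a` contributing a family with parameter `d - 1`. Uniqueness survives shifting
because shifting preserves cardinalities of members, and it survives down-compression because the
Kneser graph is connected (`eq_setBall_of_compression_eq_setBall`). Hence the hitting sets are
exactly the covering codes of radius `d` (`hitsMaxIndepSets_farGraph_iff`). In terms of sign
vectors, `x` is covered by `s` when their inner product is at least `2 t`.

*Upper bound.* The columns of a Sylvester matrix of order about `4 t²`, cut down to `4 t²`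
coordinates, are orthogonal, so by Parseval every sign vector has inner product at least `2 t` in
absolute value with some row. Extending the rows by constant signs covers the whole cube
(`exists_covering_card_le`).

*Lower bound.* By Spencer's theorem (`exists_sign_abs_sum_le`), for any `k` sign vectors there is a
sign vector whose inner products with all of them are `O(√k)`, whatever the dimension; for a
covering code this forces `2 t ≤ O(√k)`. Spencer's theorem follows by iterating the partial
colouring lemma `exists_partial_coloring`. There the entropy of the rounded sums is replaced by the
mean length of an explicit geometric code, which fourth moments control, and Jensen's inequality
gives a large fibre (`exists_card_fiber_ge`). With `n` uncoloured variables one round costs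
`O(√k)` times a power of `min (n / k) (k / n)`, so the total over all rounds is `O(√k)`, without a
preliminary reduction to at most `k` variables.
-/

open scoped FinsetFamily symmDiff

/-! ### Families with small pairwise unions -/

theorem sum_range_choose_succ_left (n d : ℕ) :
    ∑ i ∈ range (d + 2), (n + 1).choose i =
      ∑ i ∈ range (d + 2), n.choose i + ∑ i ∈ range (d + 1), n.choose i := by
  rw [sum_range_succ' _ (d + 1), sum_range_succ' (fun i => n.choose i) (d + 1)]
  simp only [Nat.choose_succ_succ', sum_add_distrib, Nat.choose_zero_right]
  ring

theorem card_powerset_filter_card_le {ι : Type*} [DecidableEq ι] (W : Finset ι) (d : ℕ) :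
    #{A ∈ W.powerset | #A ≤ d} = ∑ i ∈ range (d + 1), (#W).choose i := by
  have h : {A ∈ W.powerset | #A ≤ d} = (range (d + 1)).biUnion fun i => powersetCard i W := by
    ext A
    simp only [mem_filter, mem_powerset, mem_biUnion, mem_range, mem_powersetCard]
    constructor
    · rintro ⟨h1, h2⟩
      exact ⟨#A, by omega, h1, rfl⟩
    · rintro ⟨i, hi, h1, h2⟩
      exact ⟨h1, by omega⟩
  rw [h, card_biUnion]
  · simp
  · intro i _ j _ hij
    exact pairwise_disjoint_powersetCard W hij

theorem card_insert_erase_le {ι : Type*} [DecidableEq ι] {X : Finset ι} {a : ι} (i : ι)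
    (ha : a ∈ X) : #(insert i (X.erase a)) ≤ #X := by
  have h1 := card_insert_le i (X.erase a)
  have h2 := card_erase_add_one ha
  omega

theorem uvCompress_singleton {ι : Type*} [DecidableEq ι] {a i : ι} {T : Finset ι} (ha : a ∈ T)
    (hi : i ∉ T) : UV.compress {i} {a} T = insert i (T.erase a) := by
  have : Disjoint {i} T ∧ ({a} : Finset ι) ≤ T := by simp [ha, hi]
  rw [UV.compress, if_pos this]
  ext x
  simp only [sup_eq_union, mem_sdiff, mem_union, mem_singleton, mem_insert, mem_erase]
  grind

/-- Shifting `a` to `i` does not enlarge the largest pairwise union of a family. -/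
theorem card_union_le_of_mem_uvCompression {ι : Type*} [DecidableEq ι] {F : Finset (Finset ι)}
    {s : ℕ} {a i : ι} (hF : ∀ A ∈ F, ∀ B ∈ F, #(A ∪ B) ≤ s) :
    ∀ A ∈ UV.compression {i} {a} F, ∀ B ∈ UV.compression {i} {a} F, #(A ∪ B) ≤ s := by
  -- a member of the compression either stays, and then so does its shift, or is a shifted set
  have key : ∀ A ∈ UV.compression {i} {a} F,
      (A ∈ F ∧ (a ∈ A → i ∉ A → insert i (A.erase a) ∈ F)) ∨
      ∃ T ∈ F, a ∈ T ∧ i ∉ T ∧ A = insert i (T.erase a) := by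
    intro A hA
    rcases UV.mem_compression.1 hA with ⟨h1, h2⟩ | ⟨h1, T, hT, h2⟩
    · refine Or.inl ⟨h1, fun h3 h4 => ?_⟩
      rwa [uvCompress_singleton h3 h4] at h2
    · by_cases h3 : a ∈ T ∧ i ∉ T
      · exact Or.inr ⟨T, hT, h3.1, h3.2, by rw [← h2, uvCompress_singleton h3.1 h3.2]⟩
      · have : ¬ (Disjoint {i} T ∧ ({a} : Finset ι) ≤ T) := by
          simpa [and_comm] using h3
        rw [UV.compress, if_neg this] at h2
        exact absurd (h2 ▸ hT) h1
  -- a shifted set against a set that stays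
  have mixed : ∀ T ∈ F, a ∈ T → i ∉ T → ∀ B ∈ F,
      (a ∈ B → i ∉ B → insert i (B.erase a) ∈ F) → #(insert i (T.erase a) ∪ B) ≤ s := by
    intro T hT haT hiT B hB hB'
    by_cases h1 : i ∈ B
    · refine (card_le_card ?_).trans (hF T hT B hB)
      intro x; simp only [mem_union, mem_insert, mem_erase]; grind
    by_cases h2 : a ∈ B
    · have : insert i (T.erase a) ∪ B = T ∪ insert i (B.erase a) := by
        ext x; simp only [mem_union, mem_insert, mem_erase]; grind
      rw [this]
      exact hF T hT _ (hB' h2 h1)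
    · have : insert i (T.erase a) ∪ B = insert i ((T ∪ B).erase a) := by
        ext x; simp only [mem_union, mem_insert, mem_erase]; grind
      rw [this]
      exact (card_insert_erase_le i (by simp [haT])).trans (hF T hT B hB)
  intro A hA B hB
  rcases key A hA with ⟨hA1, hA2⟩ | ⟨T, hT, haT, hiT, rfl⟩
  · rcases key B hB with ⟨hB1, hB2⟩ | ⟨T, hT, haT, hiT, rfl⟩
    · exact hF A hA1 B hB1
    · rw [union_comm]
      exact mixed T hT haT hiT A hA1 hA2
  · rcases key B hB with ⟨hB1, hB2⟩ | ⟨R, hR, haR, hiR, rfl⟩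
    · exact mixed T hT haT hiT B hB1 hB2
    · have : insert i (T.erase a) ∪ insert i (R.erase a) = insert i ((T ∪ R).erase a) := by
        ext x; simp only [mem_union, mem_insert, mem_erase]; grind
      rw [this]
      exact (card_insert_erase_le i (by simp [haT])).trans (hF T hT R hR)

/-- On `2 d + 1` points a family with unions of size at most `2 d` contains at most one set of
each complementary pair. -/
theorem card_le_of_card_union_le_of_card_eq {ι : Type*} [DecidableEq ι] {U : Finset ι} {d : ℕ}
    {F : Finset (Finset ι)} (hU : ∀ A ∈ F, A ⊆ U) (hF : ∀ A ∈ F, ∀ B ∈ F, #(A ∪ B) ≤ 2 * d)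
    (hd : #U = 2 * d + 1) : #F ≤ ∑ i ∈ range (d + 1), (#U).choose i := by
  have hinj : Set.InjOn (fun A => U \ A) (F : Set (Finset ι)) := by
    intro A hA B hB h
    have h' : U \ A = U \ B := h
    rw [← Finset.sdiff_sdiff_eq_self (hU A hA), h', Finset.sdiff_sdiff_eq_self (hU B hB)]
  have hdis : Disjoint F (F.image fun A => U \ A) := by
    rw [disjoint_left]
    rintro A hA hA'
    obtain ⟨B, hB, rfl⟩ := mem_image.1 hA'
    have h1 := hF _ hA B hB
    rw [sdiff_union_of_subset (hU B hB)] at h1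
    omega
  have hsub : F ∪ F.image (fun A => U \ A) ⊆ U.powerset := by
    intro A hA
    rcases mem_union.1 hA with h | h
    · exact mem_powerset.2 (hU A h)
    · obtain ⟨B, hB, rfl⟩ := mem_image.1 h
      exact mem_powerset.2 sdiff_subset
  have h1 := card_le_card hsub
  rw [card_union_of_disjoint hdis, card_image_of_injOn hinj, card_powerset, hd] at h1
  rw [hd, Nat.sum_range_choose_halfway]
  have h2 : 2 ^ (2 * d + 1) = 2 * 4 ^ d := by
    rw [pow_succ, pow_mul]; norm_num; ring
  omega

/-- Shifting a set that can be shifted lowers the number of members containing `a`. -/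
theorem card_memberSubfamily_uvCompression_lt {ι : Type*} [DecidableEq ι]
    {F : Finset (Finset ι)} {a i : ι} {A : Finset ι} (hA : A ∈ F) (haA : a ∈ A)
    (hiA : i ∉ A) (hn : insert i (A.erase a) ∉ F) :
    #((UV.compression {i} {a} F).memberSubfamily a) < #(F.memberSubfamily a) := by
  have hold : ∀ B ∈ UV.compression {i} {a} F, a ∈ B → B ∈ F ∧ UV.compress {i} {a} B ∈ F := by
    intro B hB haB
    rcases UV.mem_compression.1 hB with h | ⟨h1, T, hT, h2⟩
    · exact h
    · exfalso
      rw [UV.compress] at h2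
      split_ifs at h2 with h3
      · rw [← h2] at haB
        simp at haB
      · exact h1 (h2 ▸ hT)
  apply card_lt_card
  rw [ssubset_iff_of_subset]
  · refine ⟨A.erase a, ?_, ?_⟩
    · rw [mem_memberSubfamily, insert_erase haA]
      exact ⟨hA, by simp⟩
    · rw [mem_memberSubfamily, insert_erase haA]
      rintro ⟨h, -⟩
      have := (hold A h haA).2
      rw [uvCompress_singleton haA hiA] at this
      exact hn this
  · intro B hB
    rw [mem_memberSubfamily] at hB ⊢
    exact ⟨(hold _ hB.1 (by simp)).1, hB.2⟩

/-- Katona's bound for families with pairwise unions of size at most `2 d`, and its equality case: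
on at least `2 d + 2` points an extremal family consists of sets of size at most `d`. -/
theorem card_le_of_card_union_le {ι : Type*} [DecidableEq ι] (U : Finset ι) :
    ∀ (d : ℕ) (F : Finset (Finset ι)), (∀ A ∈ F, A ⊆ U) →
      (∀ A ∈ F, ∀ B ∈ F, #(A ∪ B) ≤ 2 * d) → 2 * d + 1 ≤ #U →
      #F ≤ ∑ i ∈ range (d + 1), (#U).choose i ∧
        (2 * d + 2 ≤ #U → #F = ∑ i ∈ range (d + 1), (#U).choose i → ∀ A ∈ F, #A ≤ d) := by
  induction U using Finset.induction_on with
  | empty => intro d F _ _ h; simp at h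
  | insert a W haW ih =>
    have hcard : #(insert a W) = #W + 1 := card_insert_of_notMem haW
    intro d F hU hF hd
    rcases hd.eq_or_lt with hd' | hd'
    · exact ⟨card_le_of_card_union_le_of_card_eq hU hF hd'.symm, fun h => by omega⟩
    rcases d with _ | e
    · refine ⟨?_, fun _ _ A hA => by simpa using hF A hA A hA⟩
      have : F ⊆ {∅} := by
        intro A hA
        simpa using hF A hA A hA
      simpa using card_le_card this
    have hW : 2 * (e + 1) + 1 ≤ #W := by omega
    clear hd hd'
    -- shift to `a`-free sets until the family is stable
    induction hk : #(F.memberSubfamily a) using Nat.strong_induction_on generalizing F with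
    | _ k ihk =>
    by_cases hst : ∀ i ∈ W, ∀ A ∈ F, a ∈ A → i ∉ A → insert i (A.erase a) ∈ F
    · have hF0 := ih (e + 1) (F.nonMemberSubfamily a)
        (by
          intro A hA
          rw [mem_nonMemberSubfamily] at hA
          exact (subset_insert_iff_of_notMem hA.2).1 (hU A hA.1))
        (by
          intro A hA B hB
          rw [mem_nonMemberSubfamily] at hA hB
          exact hF A hA.1 B hB.1) hW
      have hsub : ∀ A ∈ F.memberSubfamily a, A ⊆ W := by
        intro A hA
        rw [mem_memberSubfamily] at hA
        exact (subset_insert_iff_of_notMem hA.2).1 ((subset_insert a A).trans (hU _ hA.1))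
      have hF1 := ih e (F.memberSubfamily a) hsub
        (by
          intro A hA B hB
          have hAW := hsub A hA
          have hBW := hsub B hB
          rw [mem_memberSubfamily] at hA hB
          by_contra hlt
          -- a point of `W` outside `A ∪ B` would give a union that is too large
          have hex : ∃ i ∈ W, i ∉ A ∪ B := by
            by_contra hno
            push Not at hno
            have h1 := card_le_card (show W ⊆ A ∪ B from hno)
            have h2 := hF _ hA.1 _ hB.1
            have h3 : #(A ∪ B) ≤ #(insert a A ∪ insert a B) :=
              card_le_card (union_subset_union (subset_insert _ _) (subset_insert _ _))
            omega
          obtain ⟨i, hiW, hi⟩ := hex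
          have hia : i ≠ a := fun h => haW (h ▸ hiW)
          rw [mem_union, not_or] at hi
          have h1 := hst i hiW _ hA.1 (mem_insert_self a A) (by simp [hia, hi.1])
          rw [erase_insert hA.2] at h1
          have h2 := hF _ h1 _ hB.1
          have h3 : insert i A ∪ insert a B = insert i (insert a (A ∪ B)) := by
            ext x; simp only [mem_union, mem_insert]; grind
          rw [h3, card_insert_of_notMem (by simp [hia, hi.1, hi.2]),
            card_insert_of_notMem (by simp [hA.2, hB.2])] at h2
          omega) (by omega)
      have hsum := card_memberSubfamily_add_card_nonMemberSubfamily a F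
      have hpas := sum_range_choose_succ_left (#W) e
      rw [hcard]
      refine ⟨by have := hF0.1; have := hF1.1; simp only [add_assoc, Nat.reduceAdd] at *; omega,
        fun _ heq => ?_⟩
      have heq1 : #(F.memberSubfamily a) = ∑ i ∈ range (e + 1), (#W).choose i := by
        have := hF0.1; have := hF1.1; simp only [add_assoc, Nat.reduceAdd] at *; omega
      have hle1 := hF1.2 (by omega) heq1
      have hfull : F.memberSubfamily a = {A ∈ W.powerset | #A ≤ e} := by
        apply eq_of_subset_of_card_le
        · intro A hA
          exact mem_filter.2 ⟨mem_powerset.2 (hsub A hA), hle1 A hA⟩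
        · rw [card_powerset_filter_card_le, heq1]
      intro A hA
      by_cases haA : a ∈ A
      · have h1 : A.erase a ∈ F.memberSubfamily a := by
          rw [mem_memberSubfamily, insert_erase haA]; exact ⟨hA, by simp⟩
        have h2 := hle1 _ h1
        have h3 := card_erase_add_one haA
        omega
      · by_contra hbig
        have hAW : A ⊆ W := (subset_insert_iff_of_notMem haA).1 (hU A hA)
        -- complete `A` by at most `e` points to a set of at least `2 e + 2` points of `W`
        obtain ⟨C, hCW, hCe, hAC⟩ : ∃ C ⊆ W, #C ≤ e ∧ 2 * e + 2 ≤ #(A ∪ C) := by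
          by_cases h : e ≤ #(W \ A)
          · obtain ⟨C, hC, hCc⟩ := exists_subset_card_eq h
            refine ⟨C, hC.trans sdiff_subset, hCc.le, ?_⟩
            have hdis : Disjoint A C :=
              disjoint_of_subset_right hC disjoint_sdiff
            rw [card_union_of_disjoint hdis]
            omega
          · refine ⟨W \ A, sdiff_subset, by omega, ?_⟩
            rw [union_sdiff_of_subset hAW]
            omega
        have hC : C ∈ F.memberSubfamily a := by
          rw [hfull]; exact mem_filter.2 ⟨mem_powerset.2 hCW, hCe⟩
        rw [mem_memberSubfamily] at hC
        have h1 := hF A hA _ hC.1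
        rw [union_insert, card_insert_of_notMem (by simp [haA, hC.2])] at h1
        omega
    · push Not at hst
      obtain ⟨i, hiW, A, hA, haA, hiA, hn⟩ := hst
      have hlt := card_memberSubfamily_uvCompression_lt hA haA hiA hn
      have hres := ihk _ (hk ▸ hlt) (UV.compression {i} {a} F)
        (by
          intro B hB
          rcases UV.mem_compression.1 hB with h | ⟨-, T, hT, rfl⟩
          · exact hU B h.1
          · rw [UV.compress]
            split_ifs with h
            · refine sdiff_subset.trans (union_subset (hU T hT) ?_)
              simp [hiW]
            · exact hU T hT)
        (card_union_le_of_mem_uvCompression hF) rfl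
      rw [UV.card_compression] at hres
      refine ⟨hres.1, fun h1 h2 B hB => ?_⟩
      have h3 := hres.2 h1 h2 _ (UV.compress_mem_compression hB)
      rwa [UV.card_compress (by simp)] at h3

/-! ### Families of small diameter -/

/-- The Hamming ball of radius `d` about `c`, in the cube of subsets of `ι`. -/
def setBall {ι : Type*} [Fintype ι] [DecidableEq ι] (c : Finset ι) (d : ℕ) :
    Finset (Finset ι) := {A | #(A ∆ c) ≤ d}

theorem mem_setBall {ι : Type*} [Fintype ι] [DecidableEq ι] {c A : Finset ι} {d : ℕ} :
    A ∈ setBall c d ↔ #(A ∆ c) ≤ d := by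
  simp [setBall]

theorem card_setBall {ι : Type*} [Fintype ι] [DecidableEq ι] (c : Finset ι) (d : ℕ) :
    #(setBall c d) = ∑ i ∈ range (d + 1), (Fintype.card ι).choose i := by
  rw [← card_univ, ← card_powerset_filter_card_le univ d]
  refine card_bij' (fun A _ => A ∆ c) (fun A _ => A ∆ c) ?_ ?_ ?_ ?_
  · intro A hA; simpa [setBall] using hA
  · intro A hA; simpa [setBall] using hA
  · intro A _; simp
  · intro A _; simp

theorem card_symmDiff_insert_right {ι : Type*} [DecidableEq ι] {A B : Finset ι} {a : ι}
    (hA : a ∉ A) (hB : a ∉ B) : #(A ∆ insert a B) = #(A ∆ B) + 1 := by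
  rw [← card_insert_of_notMem (show a ∉ A ∆ B by simp [mem_symmDiff, hA, hB])]
  congr 1
  ext x; simp only [mem_symmDiff, mem_insert]; grind

theorem card_symmDiff_insert_left {ι : Type*} [DecidableEq ι] {A B : Finset ι} {a : ι}
    (hA : a ∉ A) (hB : a ∉ B) : #(insert a A ∆ B) = #(A ∆ B) + 1 := by
  rw [symmDiff_comm, card_symmDiff_insert_right hB hA, symmDiff_comm]

theorem card_symmDiff_insert_insert {ι : Type*} [DecidableEq ι] {A B : Finset ι} {a : ι}
    (hA : a ∉ A) (hB : a ∉ B) : #(insert a A ∆ insert a B) = #(A ∆ B) := by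
  congr 1
  ext x; simp only [mem_symmDiff, mem_insert]; grind

/-- Down-compression does not increase the diameter of a family. -/
theorem card_symmDiff_le_of_mem_compression {ι : Type*} [DecidableEq ι] {F : Finset (Finset ι)}
    {s : ℕ} (a : ι) (hF : ∀ A ∈ F, ∀ B ∈ F, #(A ∆ B) ≤ s) :
    ∀ A ∈ 𝓓 a F, ∀ B ∈ 𝓓 a F, #(A ∆ B) ≤ s := by
  have mixed : ∀ A B, A ∈ F → A.erase a ∈ F → B ∉ F → insert a B ∈ F → #(A ∆ B) ≤ s := by
    intro A B h1 h2 h3 h4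
    have hB : a ∉ B := fun h => h3 (by rwa [insert_eq_of_mem h] at h4)
    by_cases hA : a ∈ A
    · obtain ⟨A, hA', rfl⟩ : ∃ A', a ∉ A' ∧ A = insert a A' :=
        ⟨A.erase a, by simp, (insert_erase hA).symm⟩
      rw [erase_insert hA'] at h2
      have := hF _ h2 _ h4
      rw [card_symmDiff_insert_right hA' hB] at this
      rwa [card_symmDiff_insert_left hA' hB]
    · have := hF _ h1 _ h4
      rw [card_symmDiff_insert_right hA hB] at this
      omega
  intro A hA B hB
  rcases Down.mem_compression.1 hA with ⟨hA1, hA2⟩ | ⟨hA1, hA2⟩ <;>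
    rcases Down.mem_compression.1 hB with ⟨hB1, hB2⟩ | ⟨hB1, hB2⟩
  · exact hF A hA1 B hB1
  · exact mixed A B hA1 hA2 hB1 hB2
  · rw [symmDiff_comm]
    exact mixed B A hB1 hB2 hA1 hA2
  · have hA' : a ∉ A := fun h => hA1 (by rwa [insert_eq_of_mem h] at hA2)
    have hB' : a ∉ B := fun h => hB1 (by rwa [insert_eq_of_mem h] at hB2)
    rw [← card_symmDiff_insert_insert hA' hB']
    exact hF _ hA2 _ hB2

/-- A proper down-compression lowers the total size of the members. -/
theorem sum_card_compression_lt {ι : Type*} [DecidableEq ι] {F : Finset (Finset ι)} {a : ι}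
    {A : Finset ι} (hA : A ∈ F) (hn : A.erase a ∉ F) :
    ∑ B ∈ 𝓓 a F, #B < ∑ B ∈ F, #B := by
  have hfa : ∀ {T : Finset ι}, T ∈ F → T.erase a ∉ F → a ∈ T := by
    intro T h1 h2
    by_contra h
    rw [erase_eq_of_notMem h] at h2
    exact h2 h1
  set f : Finset ι → Finset ι := fun T => if T.erase a ∈ F then T else T.erase a with hf
  have hinj : Set.InjOn f (F : Set (Finset ι)) := by
    intro S hS T hT h
    simp only [hf] at h
    split_ifs at h with h1 h2 h2
    · exact h
    · exact absurd (h ▸ hS) h2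
    · exact absurd (h ▸ hT) h1
    · rw [← insert_erase (hfa hS h1), h, insert_erase (hfa hT h2)]
  have himg : F.image f = 𝓓 a F := by
    apply eq_of_subset_of_card_le
    · intro T hT
      obtain ⟨S, hS, rfl⟩ := mem_image.1 hT
      rw [Down.mem_compression]
      simp only [hf]
      split_ifs with h
      · exact Or.inl ⟨hS, h⟩
      · exact Or.inr ⟨h, by rwa [insert_erase (hfa hS h)]⟩
    · rw [Down.card_compression, card_image_of_injOn hinj]
  rw [← himg, sum_image hinj]
  apply sum_lt_sum
  · intro T _
    simp only [hf]
    split_ifs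
    · exact le_rfl
    · exact card_le_card (erase_subset _ _)
  · refine ⟨A, hA, ?_⟩
    simp only [hf, if_neg hn]
    exact card_erase_lt_of_mem (hfa hA hn)

/-- Connectivity of the Kneser graph on the `d`-subsets of a set with at least `2 d + 1` points:
a property that passes to disjoint `d`-subsets passes to all of them. -/
theorem kneser_propagate {ι : Type*} [DecidableEq ι] {W : Finset ι} {d : ℕ}
    (hW : 2 * d + 1 ≤ #W) {P : Finset ι → Prop}
    (hP : ∀ S ⊆ W, ∀ T ⊆ W, #S = d → #T = d → Disjoint S T → P S → P T) :
    ∀ S ⊆ W, ∀ T ⊆ W, #S = d → #T = d → P S → P T := by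
  intro S hS T hT hSd hTd hPS
  induction hk : #(T \ S) using Nat.strong_induction_on generalizing S with
  | _ k ih =>
  by_cases h0 : T ⊆ S
  · have := eq_of_subset_of_card_le h0 (by omega)
    exact this ▸ hPS
  obtain ⟨y, hyT, hyS⟩ := not_subset.1 h0
  have h1 : ¬ S ⊆ T := fun h => h0 (eq_of_subset_of_card_le h (by omega)).symm.subset
  obtain ⟨x, hxS, hxT⟩ := not_subset.1 h1
  -- exchange `x` for `y`: both sets have a common disjoint neighbour
  have hcS : #(insert y S) = d + 1 := by rw [card_insert_of_notMem hyS, hSd]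
  have hins : insert y S ⊆ W := insert_subset (hT hyT) hS
  obtain ⟨R, hR, hRd⟩ := exists_subset_card_eq
    (show d ≤ #(W \ insert y S) by rw [card_sdiff_of_subset hins]; omega)
  have hdis : Disjoint (insert y S) R := disjoint_of_subset_right hR disjoint_sdiff
  have hS1 : insert y (S.erase x) ⊆ insert y S := insert_subset_insert _ (erase_subset _ _)
  have hS1d : #(insert y (S.erase x)) = d := by
    rw [card_insert_of_notMem (by simp [hyS]), card_erase_add_one hxS, hSd]
  have hRW : R ⊆ W := hR.trans sdiff_subset
  have hPR : P R := hP S hS R hRW hSd hRd (disjoint_of_subset_left (subset_insert _ _) hdis) hPS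
  have hPS1 := hP R hRW _ (hS1.trans hins) hRd hS1d (disjoint_of_subset_left hS1 hdis).symm hPR
  refine ih _ ?_ _ (hS1.trans hins) hS1d hPS1 rfl
  rw [← hk]
  apply card_lt_card
  rw [ssubset_iff_of_subset]
  · exact ⟨y, by simp [hyT, hyS], by simp⟩
  · intro z
    simp only [mem_sdiff, mem_insert, mem_erase]
    rintro ⟨hz, hz2⟩
    exact ⟨hz, fun h => hz2 (Or.inr ⟨fun h' => hxT (h' ▸ hz), h⟩)⟩

/-- If a down-compression of a family of diameter at most `2 d` is a ball, so is the family: the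
sphere of the ball is split between two facets, antipodal points of it must lie in the same
facet, and the Kneser graph is connected. -/
theorem eq_setBall_of_compression_eq_setBall {ι : Type*} [Fintype ι] [DecidableEq ι] {d : ℕ}
    (hd : 2 * d + 2 ≤ Fintype.card ι) {F : Finset (Finset ι)}
    (hF : ∀ A ∈ F, ∀ B ∈ F, #(A ∆ B) ≤ 2 * d) {a : ι} {c : Finset ι}
    (hc : 𝓓 a F = setBall c d) : ∃ c', F = setBall c' d := by
  have hcard : #F = ∑ i ∈ range (d + 1), (Fintype.card ι).choose i := by
    rw [← Down.card_compression a F, hc, card_setBall]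
  have hWc : #((univ : Finset ι).erase a) + 1 = Fintype.card ι := by
    rw [card_erase_add_one (mem_univ a), card_univ]
  set W := (univ : Finset ι).erase a with hWdef
  have haW : ∀ {T : Finset ι}, T ⊆ W → a ∉ T := fun h h' => by
    have := h h'; simp [hWdef] at this
  have hac : a ∉ c := by
    intro hac
    obtain ⟨T, hT, hTd⟩ := exists_subset_card_eq (show d ≤ #W by omega)
    have h1 : c ∆ T ∈ setBall c d := by
      rw [mem_setBall, symmDiff_comm c T, symmDiff_symmDiff_cancel_right]; omega
    have h2 := Down.erase_mem_compression_of_mem_compression (a := a) (hc.symm ▸ h1)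
    rw [hc, mem_setBall] at h2
    have h3 : (c ∆ T).erase a ∆ c = insert a T := by
      have := haW hT
      ext x; simp only [mem_symmDiff, mem_erase, mem_insert]; grind
    rw [h3, card_insert_of_notMem (haW hT)] at h2
    omega
  -- inside the smaller ball both `A` and `insert a A` lie in `F`
  have hin : ∀ A, a ∉ A → #(A ∆ c) + 1 ≤ d → A ∈ F ∧ insert a A ∈ F := by
    intro A haA h
    have h1 : insert a A ∈ 𝓓 a F := by
      rw [hc, mem_setBall, card_symmDiff_insert_left haA hac]; exact h
    rcases Down.mem_compression.1 h1 with ⟨h2, h3⟩ | ⟨h2, h3⟩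
    · rw [erase_insert haA] at h3; exact ⟨h3, h2⟩
    · rw [insert_eq_of_mem (mem_insert_self a A)] at h3; exact absurd h3 h2
  have hon : ∀ A, #(A ∆ c) ≤ d → A ∈ F ∨ insert a A ∈ F := by
    intro A h
    have h1 : A ∈ 𝓓 a F := by rw [hc, mem_setBall]; exact h
    rcases Down.mem_compression.1 h1 with ⟨h2, -⟩ | ⟨-, h2⟩
    · exact Or.inl h2
    · exact Or.inr h2
  have haT : ∀ {T : Finset ι}, a ∉ T → a ∉ c ∆ T := by
    intro T h; simp [mem_symmDiff, hac, h]
  have hdist : ∀ T : Finset ι, #((c ∆ T) ∆ c) = #T := by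
    intro T; rw [symmDiff_comm c T, symmDiff_symmDiff_cancel_right]
  have hprop := kneser_propagate (W := W) (d := d) (by omega) (P := fun T => c ∆ T ∈ F)
    (by
      intro S hS T hT hSd hTd hdis hPS
      by_contra hPT
      have h1 := (hon (c ∆ T) (by rw [hdist]; omega)).resolve_left hPT
      have h2 := hF _ hPS _ h1
      have h3 : (c ∆ S) ∆ (c ∆ T) = S ∪ T := by
        rw [symmDiff_symmDiff_symmDiff_comm, symmDiff_self, bot_symmDiff,
          hdis.symmDiff_eq_sup, sup_eq_union]
      rw [card_symmDiff_insert_right (haT (haW hS)) (haT (haW hT)), h3,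
        card_union_of_disjoint hdis] at h2
      omega)
  have hsph : ∀ A, a ∉ A → c ∆ A ⊆ W ∧ c ∆ (c ∆ A) = A := by
    intro A haA
    refine ⟨fun x hx => ?_, symmDiff_symmDiff_cancel_left c A⟩
    rw [hWdef, mem_erase]
    exact ⟨fun h => haT haA (h ▸ hx), mem_univ _⟩
  by_cases hex : ∃ S ⊆ W, #S = d ∧ c ∆ S ∈ F
  · obtain ⟨S, hSW, hSd, hSF⟩ := hex
    refine ⟨c, (eq_of_subset_of_card_le ?_ (by rw [card_setBall, hcard])).symm⟩
    intro B hB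
    rw [mem_setBall] at hB
    by_cases haB : a ∈ B
    · rw [← insert_erase haB] at hB ⊢
      rw [card_symmDiff_insert_left (by simp) hac] at hB
      exact (hin _ (by simp) hB).2
    · rcases Nat.lt_or_ge (#(B ∆ c)) d with h | h
      · exact (hin _ haB h).1
      · have h1 := hprop S hSW (c ∆ B) (hsph B haB).1 hSd
          (by rw [symmDiff_comm]; omega) hSF
        rwa [(hsph B haB).2] at h1
  · push Not at hex
    refine ⟨insert a c, (eq_of_subset_of_card_le ?_ (by rw [card_setBall, hcard])).symm⟩
    intro B hB
    rw [mem_setBall] at hB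
    by_cases haB : a ∈ B
    · rw [← insert_erase haB] at hB ⊢
      have ha' : a ∉ B.erase a := by simp
      rw [card_symmDiff_insert_insert ha' hac] at hB
      rcases Nat.lt_or_ge (#(B.erase a ∆ c)) d with h | h
      · exact (hin _ ha' h).2
      · refine (hon _ hB).resolve_left fun h1 => ?_
        refine hex (c ∆ B.erase a) (hsph _ ha').1 (by rw [symmDiff_comm]; omega) ?_
        rwa [(hsph _ ha').2]
    · rw [card_symmDiff_insert_right haB hac] at hB
      exact (hin _ haB hB).1

/-- Kleitman's diameter theorem for even diameter, with its equality case: in dimension at least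
`2 d + 2` the balls of radius `d` are the only largest families of diameter at most `2 d`. -/
theorem card_le_of_card_symmDiff_le {ι : Type*} [Fintype ι] [DecidableEq ι] {d : ℕ}
    (hd : 2 * d + 2 ≤ Fintype.card ι) {F : Finset (Finset ι)}
    (hF : ∀ A ∈ F, ∀ B ∈ F, #(A ∆ B) ≤ 2 * d) :
    #F ≤ ∑ i ∈ range (d + 1), (Fintype.card ι).choose i ∧
      (#F = ∑ i ∈ range (d + 1), (Fintype.card ι).choose i → ∃ c, F = setBall c d) := by
  induction hk : ∑ A ∈ F, #A using Nat.strong_induction_on generalizing F with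
  | _ k ih =>
  by_cases hst : ∀ a, ∀ A ∈ F, A.erase a ∈ F
  · -- a down-set: distances `A ∆ (B \ A)` are sizes of unions
    have hdown : ∀ A B, B ∈ F → B \ A ∈ F := by
      intro A
      induction A using Finset.induction_on with
      | empty => intro B hB; simpa using hB
      | insert x A _ ihA =>
        intro B hB
        rw [sdiff_insert]
        exact hst x _ (ihA B hB)
    have h := card_le_of_card_union_le univ d F (fun A _ => subset_univ A)
      (by
        intro A hA B hB
        have h1 := hF A hA _ (hdown A B hB)
        have h2 : A ∆ (B \ A) = A ∪ B := by
          ext x; simp only [mem_symmDiff, mem_sdiff, mem_union]; grind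
        rwa [h2] at h1)
      (by rw [card_univ]; omega)
    rw [card_univ] at h
    refine ⟨h.1, fun heq => ⟨∅, eq_of_subset_of_card_le ?_ ?_⟩⟩
    · intro A hA
      rw [mem_setBall, ← bot_eq_empty, symmDiff_bot]
      exact h.2 hd heq A hA
    · rw [card_setBall, heq]
  · push Not at hst
    obtain ⟨a, A, hA, hn⟩ := hst
    have h := ih _ (hk ▸ sum_card_compression_lt hA hn)
      (card_symmDiff_le_of_mem_compression a hF) rfl
    rw [Down.card_compression] at h
    refine ⟨h.1, fun heq => ?_⟩
    obtain ⟨c, hc⟩ := h.2 heq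
    exact eq_setBall_of_compression_eq_setBall hd hF hc

/-! ### The maximum independent sets are the Hamming balls -/

/-- The identification of binary vectors with subsets of the index set. -/
def boolSupportEquiv (ι : Type*) [Fintype ι] [DecidableEq ι] : (ι → Bool) ≃ Finset ι where
  toFun x := {j | x j = true}
  invFun A := fun j => decide (j ∈ A)
  left_inv x := by ext j; simp
  right_inv A := by ext j; simp

theorem card_boolSupportEquiv_symmDiff {ι : Type*} [Fintype ι] [DecidableEq ι] (x y : ι → Bool) :
    #(boolSupportEquiv ι x ∆ boolSupportEquiv ι y) = hammingDist x y := by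
  rw [hammingDist]
  congr 1
  ext j
  simp only [boolSupportEquiv, Equiv.coe_fn_mk, mem_symmDiff, mem_filter, mem_univ, true_and]
  cases x j <;> cases y j <;> simp

/-- The Hamming ball of radius `d` about `c` in the cube `{0,1}^ι`. -/
def hammingBall {ι : Type*} [Fintype ι] [DecidableEq ι] (c : ι → Bool) (d : ℕ) :
    Finset (ι → Bool) := {x | hammingDist x c ≤ d}

theorem mem_hammingBall {ι : Type*} [Fintype ι] [DecidableEq ι] {c x : ι → Bool} {d : ℕ} :
    x ∈ hammingBall c d ↔ hammingDist x c ≤ d := by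
  simp [hammingBall]

theorem map_hammingBall {ι : Type*} [Fintype ι] [DecidableEq ι] (c : ι → Bool) (d : ℕ) :
    (hammingBall c d).map (boolSupportEquiv ι).toEmbedding =
      setBall (boolSupportEquiv ι c) d := by
  ext A
  obtain ⟨x, rfl⟩ := (boolSupportEquiv ι).surjective A
  rw [mem_setBall, card_boolSupportEquiv_symmDiff, mem_map_equiv, Equiv.symm_apply_apply,
    mem_hammingBall]

theorem card_hammingBall {ι : Type*} [Fintype ι] [DecidableEq ι] (c : ι → Bool) (d : ℕ) :
    #(hammingBall c d) = ∑ i ∈ range (d + 1), (Fintype.card ι).choose i := by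
  rw [← card_setBall (boolSupportEquiv ι c), ← map_hammingBall, card_map]

theorem isIndepSet_farGraph_iff {m t : ℕ} {I : Finset (Fin m → Bool)} :
    (farGraph m t).IsIndepSet (I : Set (Fin m → Bool)) ↔
      ∀ x ∈ I, ∀ y ∈ I, hammingDist x y ≤ m - 2 * t := by
  constructor
  · intro h x hx y hy
    by_cases hxy : x = y
    · simp [hxy]
    · have := h hx hy hxy
      simpa [farGraph] using this
  · intro h x hx y hy _
    have := h x hx y hy
    simpa [farGraph] using this

theorem isIndepSet_hammingBall {m t d : ℕ} (hd : 2 * d = m - 2 * t) (c : Fin m → Bool) :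
    (farGraph m t).IsIndepSet (hammingBall c d : Set (Fin m → Bool)) := by
  rw [isIndepSet_farGraph_iff]
  intro x hx y hy
  rw [mem_hammingBall] at hx hy
  have := hammingDist_triangle_right x y c
  omega

theorem card_le_of_isIndepSet_farGraph {m t d : ℕ} (ht : 0 < t) (htm : 2 * t ≤ m)
    (hd : 2 * d = m - 2 * t) {I : Finset (Fin m → Bool)}
    (hI : (farGraph m t).IsIndepSet (I : Set (Fin m → Bool))) :
    #I ≤ ∑ i ∈ range (d + 1), m.choose i ∧
      (#I = ∑ i ∈ range (d + 1), m.choose i → ∃ c, I = hammingBall c d) := by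
  rw [isIndepSet_farGraph_iff] at hI
  have h := card_le_of_card_symmDiff_le (ι := Fin m) (d := d)
    (F := I.map (boolSupportEquiv (Fin m)).toEmbedding) (by rw [Fintype.card_fin]; omega)
    (by
      intro A hA B hB
      obtain ⟨x, hx, rfl⟩ := mem_map.1 hA
      obtain ⟨y, hy, rfl⟩ := mem_map.1 hB
      rw [hd]
      exact (card_boolSupportEquiv_symmDiff x y).trans_le (hI x hx y hy))
  rw [card_map, Fintype.card_fin] at h
  refine ⟨h.1, fun heq => ?_⟩
  obtain ⟨C, hC⟩ := h.2 heq
  obtain ⟨c, rfl⟩ := (boolSupportEquiv (Fin m)).surjective C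
  rw [← map_hammingBall] at hC
  exact ⟨c, map_injective _ hC⟩

theorem indepNum_farGraph {m t d : ℕ} (ht : 0 < t) (htm : 2 * t ≤ m) (hd : 2 * d = m - 2 * t) :
    (farGraph m t).indepNum = ∑ i ∈ range (d + 1), m.choose i := by
  apply le_antisymm
  · obtain ⟨I, hI⟩ := (farGraph m t).exists_isNIndepSet_indepNum
    rw [← hI.card_eq]
    exact (card_le_of_isIndepSet_farGraph ht htm hd hI.isIndepSet).1
  · have h := (isIndepSet_hammingBall hd (fun _ : Fin m => false)).card_le_indepNum
    rwa [card_hammingBall, Fintype.card_fin] at h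

theorem isMaximumIndepSet_farGraph_iff {m t d : ℕ} (ht : 0 < t) (htm : 2 * t ≤ m)
    (hd : 2 * d = m - 2 * t) {I : Finset (Fin m → Bool)} :
    (farGraph m t).IsMaximumIndepSet I ↔ ∃ c, I = hammingBall c d := by
  constructor
  · intro hI
    refine (card_le_of_isIndepSet_farGraph ht htm hd hI.isIndepSet).2 ?_
    rw [← indepNum_farGraph ht htm hd]
    exact (farGraph m t).maximumIndepSet_card_eq_indepNum I hI
  · rintro ⟨c, rfl⟩
    refine ⟨isIndepSet_hammingBall hd c, fun J hJ => ?_⟩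
    rw [card_hammingBall, Fintype.card_fin]
    exact (card_le_of_isIndepSet_farGraph ht htm hd hJ).1

/-- The sets hitting all maximum independent sets are the covering codes of radius `d`. -/
theorem hitsMaxIndepSets_farGraph_iff {m t d : ℕ} (ht : 0 < t) (htm : 2 * t ≤ m)
    (hd : 2 * d = m - 2 * t) {S : Finset (Fin m → Bool)} :
    HitsMaxIndepSets (farGraph m t) S ↔ ∀ c, ∃ s ∈ S, hammingDist s c ≤ d := by
  constructor
  · intro h c
    obtain ⟨s, hs⟩ := h _ ((isMaximumIndepSet_farGraph_iff ht htm hd).2 ⟨c, rfl⟩)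
    rw [mem_inter, mem_hammingBall] at hs
    exact ⟨s, hs⟩
  · intro h I hI
    obtain ⟨c, rfl⟩ := (isMaximumIndepSet_farGraph_iff ht htm hd).1 hI
    obtain ⟨s, hs, hsc⟩ := h c
    exact ⟨s, mem_inter.2 ⟨hs, mem_hammingBall.2 hsc⟩⟩

/-! ### A covering code from a Hadamard matrix -/

/-- The sign of a bit: `1` for `true` and `-1` for `false`. -/
def boolSign (b : Bool) : ℝ := if b then 1 else -1

theorem boolSign_mul_self (b : Bool) : boolSign b * boolSign b = 1 := by
  cases b <;> simp [boolSign]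

theorem boolSign_not (b : Bool) : boolSign (!b) = -boolSign b := by
  cases b <;> simp [boolSign]

theorem sum_boolSign_mul {ι : Type*} [Fintype ι] (x y : ι → Bool) :
    ∑ j, boolSign (x j) * boolSign (y j) = Fintype.card ι - 2 * (hammingDist x y : ℝ) := by
  have h : ∀ j, boolSign (x j) * boolSign (y j) = 1 - 2 * (if x j ≠ y j then 1 else 0 : ℝ) := by
    intro j
    cases x j <;> cases y j <;> norm_num [boolSign]
  simp_rw [h, sum_sub_distrib, ← mul_sum, sum_boole]
  simp [hammingDist]

/-- Distinct rows of the Sylvester matrix are orthogonal. -/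
theorem sum_prod_boolSign_eq_zero {κ : Type*} [Fintype κ] [DecidableEq κ] {a b : κ → Bool}
    (hab : a ≠ b) :
    ∑ y : κ → Bool, (∏ k, boolSign (!(a k && y k))) * (∏ k, boolSign (!(b k && y k))) = 0 := by
  simp_rw [← prod_mul_distrib]
  rw [← Fintype.prod_sum (fun k (c : Bool) => boolSign (!(a k && c)) * boolSign (!(b k && c)))]
  obtain ⟨k, hk⟩ := Function.ne_iff.1 hab
  apply prod_eq_zero (mem_univ k)
  cases ha : a k <;> cases hb : b k <;> simp_all [boolSign]

/-- Every sign vector on at most `2 ^ #κ` coordinates has a large inner product with some column of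
the Sylvester matrix, since the columns form an orthogonal system. -/
theorem exists_card_le_sq_sum_mul_prod {ι κ : Type*} [Fintype κ] [DecidableEq κ] {T : Finset ι}
    {a : ι → κ → Bool} (ha : Set.InjOn a T) {x : ι → ℝ} (hx : ∀ j, x j * x j = 1) :
    ∃ y : κ → Bool, (#T : ℝ) ≤ (∑ j ∈ T, x j * ∏ k, boolSign (!(a j k && y k))) ^ 2 := by
  set H : ι → (κ → Bool) → ℝ := fun j y => ∏ k, boolSign (!(a j k && y k)) with hH
  have hHsq : ∀ j y, H j y * H j y = 1 := by
    intro j y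
    rw [hH, ← prod_mul_distrib]
    exact prod_eq_one fun k _ => boolSign_mul_self _
  have hsum : ∑ y : κ → Bool, (∑ j ∈ T, x j * H j y) ^ 2 = ∑ _y : κ → Bool, (#T : ℝ) := by
    have h1 : ∀ y, (∑ j ∈ T, x j * H j y) ^ 2 =
        ∑ j ∈ T, ∑ i ∈ T, x j * x i * (H j y * H i y) := by
      intro y
      rw [sq, sum_mul_sum]
      exact sum_congr rfl fun j _ => sum_congr rfl fun i _ => by ring
    simp_rw [h1]
    rw [sum_comm]
    have h2 : ∀ j ∈ T, ∑ y : κ → Bool, ∑ i ∈ T, x j * x i * (H j y * H i y) =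
        ∑ _y : κ → Bool, (1 : ℝ) := by
      intro j hj
      rw [sum_comm, sum_eq_single_of_mem j hj]
      · simp [hHsq, hx]
      · intro i hi hij
        rw [← mul_sum, sum_prod_boolSign_eq_zero (fun h => hij (ha hj hi h).symm), mul_zero]
    rw [sum_congr rfl h2]
    simp [mul_comm]
  obtain ⟨y, -, hy⟩ := exists_le_of_sum_le (univ_nonempty (α := κ → Bool)) hsum.ge
  exact ⟨y, hy⟩

theorem boolSign_decide_pos {p : ℝ} (hp : p * p = 1) : boolSign (decide (0 < p)) = p := by
  rcases mul_self_eq_one_iff.1 hp with rfl | rfl <;> norm_num [boolSign]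

/-- The Hadamard codewords cover the cube: the signs on the first `4 t²` coordinates come from a
Sylvester matrix of order between `4 t²` and `8 t²`, those on the rest are constant, and both
parts may be negated. With four choices of signs this gives at most `32 t²` codewords. -/
theorem exists_covering_card_le {m t : ℕ} (ht : 0 < t) (htm : 4 * t ^ 2 ≤ m) :
    ∃ S : Finset (Fin m → Bool), #S ≤ 32 * t ^ 2 ∧
      ∀ c, ∃ s ∈ S, 2 * hammingDist s c + 2 * t ≤ m := by
  obtain ⟨r, hr1, hr2⟩ : ∃ r : ℕ, 4 * t ^ 2 ≤ 2 ^ r ∧ 2 ^ r ≤ 8 * t ^ 2 := by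
    have h0 : 1 ≤ t ^ 2 := Nat.one_le_pow _ _ ht
    refine ⟨Nat.clog 2 (4 * t ^ 2), Nat.le_pow_clog (by norm_num) _, ?_⟩
    have h1 := Nat.pow_pred_clog_lt_self (b := 2) (by norm_num) (show 1 < 4 * t ^ 2 by omega)
    have h2 : 0 < Nat.clog 2 (4 * t ^ 2) := Nat.clog_pos (by norm_num) (by omega)
    obtain ⟨q, hq⟩ := Nat.exists_eq_succ_of_ne_zero h2.ne'
    rw [hq] at h1 ⊢
    simp only [Nat.pred_succ, Nat.succ_eq_add_one] at h1 ⊢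
    rw [pow_succ]
    omega
  set T : Finset (Fin m) := {j | j.val < 4 * t ^ 2} with hT
  have hTcard : #T = 4 * t ^ 2 := by
    rw [hT, Fin.card_filter_val_lt]; omega
  set a : Fin m → Fin r → Bool := fun j k => j.val.testBit k with ha
  have hainj : Set.InjOn a T := by
    intro i hi j hj hij
    have hi' : i.val < 2 ^ r := lt_of_lt_of_le (by simpa [hT] using hi) hr1
    have hj' : j.val < 2 ^ r := lt_of_lt_of_le (by simpa [hT] using hj) hr1
    apply Fin.ext
    apply Nat.eq_of_testBit_eq
    intro k
    by_cases hk : k < r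
    · exact congrFun hij ⟨k, hk⟩
    · have hpow : 2 ^ r ≤ 2 ^ k := Nat.pow_le_pow_right (by norm_num) (by omega)
      rw [Nat.testBit_lt_two_pow (hi'.trans_le hpow), Nat.testBit_lt_two_pow (hj'.trans_le hpow)]
  set H : Fin m → (Fin r → Bool) → ℝ := fun j y => ∏ k, boolSign (!(a j k && y k)) with hH
  have hHsq : ∀ j y, H j y * H j y = 1 := by
    intro j y
    rw [hH, ← prod_mul_distrib]
    exact prod_eq_one fun k _ => boolSign_mul_self _
  -- the codewords: `p.1` selects the row, `p.2.1` and `p.2.2` the signs of the two parts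
  set w : (Fin r → Bool) × Bool × Bool → Fin m → Bool := fun p j =>
    if j ∈ T then (if p.2.1 then decide (0 < H j p.1) else !decide (0 < H j p.1)) else p.2.2
    with hw
  have hwT : ∀ p, ∀ j ∈ T, boolSign (w p j) = boolSign p.2.1 * H j p.1 := by
    intro p j hj
    have h1 : ∀ b : Bool, boolSign (if b then decide (0 < H j p.1) else !decide (0 < H j p.1)) =
        boolSign b * H j p.1 := by
      intro b
      cases b
      · simp [boolSign_not, boolSign_decide_pos (hHsq _ _)]; simp [boolSign]
      · simp [boolSign_decide_pos (hHsq _ _)]; simp [boolSign]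
    rw [hw]
    simp only [if_pos hj]
    exact h1 _
  have hwc : ∀ p, ∀ j ∈ Tᶜ, boolSign (w p j) = boolSign p.2.2 := by
    intro p j hj
    rw [mem_compl] at hj
    simp [hw, hj]
  have hsgn : ∀ X : ℝ, ∃ b, boolSign b * X = |X| := by
    intro X
    rcases abs_cases X with ⟨h, -⟩ | ⟨h, -⟩
    · exact ⟨true, by simp [boolSign, h]⟩
    · exact ⟨false, by simp [boolSign, h]⟩
  refine ⟨univ.image w, ?_, fun c => ?_⟩
  · refine card_image_le.trans ?_
    simp only [card_univ, Fintype.card_prod, Fintype.card_fun, Fintype.card_bool,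
      Fintype.card_fin]
    omega
  · obtain ⟨y, hy⟩ := exists_card_le_sq_sum_mul_prod hainj
      (x := fun j => boolSign (c j)) (fun j => boolSign_mul_self _)
    obtain ⟨σ, hσ⟩ := hsgn (∑ j ∈ T, boolSign (c j) * H j y)
    obtain ⟨τ, hτ⟩ := hsgn (∑ j ∈ Tᶜ, boolSign (c j))
    refine ⟨w (y, σ, τ), mem_image_of_mem _ (mem_univ _), ?_⟩
    have h1 := sum_boolSign_mul (w (y, σ, τ)) c
    rw [← sum_add_sum_compl T, sum_congr rfl (fun j hj => by rw [hwT _ j hj]),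
      sum_congr (s₁ := Tᶜ) rfl (fun j hj => by rw [hwc _ j hj]), ← mul_sum, hτ] at h1
    have h2 : ∑ j ∈ T, boolSign σ * H j y * boolSign (c j) =
        |∑ j ∈ T, boolSign (c j) * H j y| := by
      rw [← hσ, mul_sum]
      exact sum_congr rfl fun j _ => by ring
    simp only [h2, Fintype.card_fin] at h1
    have h3 : (2 * t : ℝ) ≤ |∑ j ∈ T, boolSign (c j) * H j y| := by
      refine (le_abs_self _).trans (sq_le_sq.1 ?_)
      rw [hTcard] at hy
      push_cast at hy
      linarith
    have h4 := abs_nonneg (∑ j ∈ Tᶜ, boolSign (c j))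
    have h5 : (2 * hammingDist (w (y, σ, τ)) c + 2 * t : ℝ) ≤ m := by linarith
    exact_mod_cast h5

/-! ### Moments of sign sums -/

/-- Averaging over the sign of one coordinate. -/
theorem two_mul_sum_insert_boolSign {ι : Type*} [Fintype ι] [DecidableEq ι] (v : ι → ℝ) (g : ℝ → ℝ)
    {s : Finset ι} {a : ι} (ha : a ∉ s) :
    2 * ∑ ε : ι → Bool, g (∑ j ∈ insert a s, boolSign (ε j) * v j) =
      ∑ ε : ι → Bool, (g (∑ j ∈ s, boolSign (ε j) * v j + v a) +
        g (∑ j ∈ s, boolSign (ε j) * v j - v a)) := by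
  have hinv : Function.Involutive fun ε : ι → Bool => Function.update ε a (!ε a) := by
    intro ε; simp
  have hflip := Equiv.sum_comp hinv.toPerm
    fun ε : ι → Bool => g (∑ j ∈ insert a s, boolSign (ε j) * v j)
  rw [two_mul]
  nth_rewrite 1 [← hflip]
  rw [← sum_add_distrib]
  refine sum_congr rfl fun ε _ => ?_
  have h1 : ∑ j ∈ s, boolSign (Function.update ε a (!ε a) j) * v j =
      ∑ j ∈ s, boolSign (ε j) * v j := by
    refine sum_congr rfl fun j hj => ?_
    rw [Function.update_of_ne (ne_of_mem_of_not_mem hj ha)]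
  simp only [Function.Involutive.coe_toPerm, sum_insert ha, h1, Function.update_self]
  cases ε a
  · simp only [boolSign]
    norm_num
    ring_nf
  · simp only [boolSign]
    norm_num
    ring_nf

theorem sum_sq_sum_boolSign_le {ι : Type*} [Fintype ι] [DecidableEq ι] {v : ι → ℝ}
    (hv : ∀ j, |v j| ≤ 1) (s : Finset ι) :
    ∑ ε : ι → Bool, (∑ j ∈ s, boolSign (ε j) * v j) ^ 2 ≤ #s * 2 ^ Fintype.card ι := by
  induction s using Finset.induction_on with
  | empty => simp
  | insert a s ha ih =>
    have h := two_mul_sum_insert_boolSign v (fun x => x ^ 2) ha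
    have hva : v a ^ 2 ≤ 1 := (sq_le_one_iff_abs_le_one _).2 (hv a)
    have h2 : ∑ ε : ι → Bool, ((∑ j ∈ s, boolSign (ε j) * v j + v a) ^ 2 +
        (∑ j ∈ s, boolSign (ε j) * v j - v a) ^ 2) ≤
        ∑ ε : ι → Bool, (2 * (∑ j ∈ s, boolSign (ε j) * v j) ^ 2 + 2) :=
      sum_le_sum fun ε _ => by nlinarith
    simp only [sum_add_distrib, ← mul_sum, sum_const, card_univ,
      Fintype.card_fun, Fintype.card_bool, nsmul_eq_mul] at h2
    rw [card_insert_of_notMem ha]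
    push_cast at h2 ⊢
    simp only [sum_add_distrib] at h
    linarith

theorem sum_pow_four_sum_boolSign_le {ι : Type*} [Fintype ι] [DecidableEq ι] {v : ι → ℝ}
    (hv : ∀ j, |v j| ≤ 1) (s : Finset ι) :
    ∑ ε : ι → Bool, (∑ j ∈ s, boolSign (ε j) * v j) ^ 4 ≤ 3 * #s ^ 2 * 2 ^ Fintype.card ι := by
  induction s using Finset.induction_on with
  | empty => simp
  | insert a s ha ih =>
    have h := two_mul_sum_insert_boolSign v (fun x => x ^ 4) ha
    have hva : v a ^ 2 ≤ 1 := (sq_le_one_iff_abs_le_one _).2 (hv a)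
    have hpt : ∀ Y : ℝ, (Y + v a) ^ 4 + (Y - v a) ^ 4 ≤ 2 * Y ^ 4 + 12 * Y ^ 2 + 2 := by
      intro Y
      have h1 : Y ^ 2 * v a ^ 2 ≤ Y ^ 2 * 1 := mul_le_mul_of_nonneg_left hva (sq_nonneg Y)
      have h2 : v a ^ 2 * v a ^ 2 ≤ 1 * 1 := mul_le_mul hva hva (sq_nonneg _) zero_le_one
      have h3 : (Y + v a) ^ 4 + (Y - v a) ^ 4 =
        2 * Y ^ 4 + 12 * (Y ^ 2 * v a ^ 2) + 2 * (v a ^ 2 * v a ^ 2) := by ring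
      rw [h3]; linarith
    have h2 := sum_le_sum fun (ε : ι → Bool) (_ : ε ∈ univ) =>
      hpt (∑ j ∈ s, boolSign (ε j) * v j)
    simp only [sum_add_distrib, ← mul_sum, sum_const, card_univ,
      Fintype.card_fun, Fintype.card_bool, nsmul_eq_mul] at h2
    rw [card_insert_of_notMem ha]
    have hsq := sum_sq_sum_boolSign_le hv s
    have hpow : (0 : ℝ) ≤ 2 ^ Fintype.card ι := by positivity
    push_cast at h2 ⊢
    simp only [sum_add_distrib] at h
    linarith

/-! ### Large fibres from short codes -/

/-- If the values of `b` have a product code with code lengths `ℓ` (satisfying Kraft's inequality)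
whose mean length is at most `E`, then by Jensen's inequality some fibre of `b` contains a
proportion `exp (-E)` of all points. -/
theorem exists_card_fiber_ge {Ω κ : Type*} [Fintype Ω] [Nonempty Ω] [Fintype κ] [DecidableEq κ]
    {ℓ : ℤ → ℝ} (hℓ : ∀ J : Finset ℤ, ∑ j ∈ J, Real.exp (-ℓ j) ≤ 1) (b : Ω → κ → ℤ) {E : ℝ}
    (hE : ∑ ω, ∑ i, ℓ (b ω i) ≤ Fintype.card Ω * E) :
    ∃ p, Fintype.card Ω * Real.exp (-E) ≤ #{ω | b ω = p} := by
  by_contra! hlt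
  have hpos : (0 : ℝ) < Fintype.card Ω * Real.exp (-E) := by
    have : 0 < Fintype.card Ω := Fintype.card_pos
    positivity
  have hkraft : ∑ p ∈ univ.image b, Real.exp (-∑ i, ℓ (p i)) ≤ 1 := by
    calc ∑ p ∈ univ.image b, Real.exp (-∑ i, ℓ (p i))
        ≤ ∑ p ∈ Fintype.piFinset fun i => (univ.image b).image fun p => p i,
            Real.exp (-∑ i, ℓ (p i)) := by
          apply sum_le_sum_of_subset_of_nonneg
          · intro p hp
            exact Fintype.mem_piFinset.2 fun i => mem_image_of_mem _ hp
          · intro p _ _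
            positivity
      _ = ∏ i, ∑ j ∈ (univ.image b).image fun p => p i, Real.exp (-ℓ j) := by
          rw [prod_univ_sum]
          refine sum_congr rfl fun p _ => ?_
          rw [← sum_neg_distrib, Real.exp_sum]
      _ ≤ 1 := prod_le_one (fun i _ => sum_nonneg fun j _ => (Real.exp_pos _).le)
          fun i _ => hℓ _
  have hjensen : Fintype.card Ω * Real.exp (-E) ≤ ∑ ω, Real.exp (-∑ i, ℓ (b ω i)) := by
    calc Fintype.card Ω * Real.exp (-E)
        ≤ ∑ ω, Real.exp (-E) * (1 + E - ∑ i, ℓ (b ω i)) := by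
          rw [← mul_sum, sum_sub_distrib, mul_comm]
          simp only [sum_const, card_univ, nsmul_eq_mul]
          have := Real.exp_pos (-E)
          apply mul_le_mul_of_nonneg_left _ this.le
          linarith
      _ ≤ ∑ ω, Real.exp (-∑ i, ℓ (b ω i)) := by
          refine sum_le_sum fun ω _ => ?_
          have h1 := Real.add_one_le_exp (E - ∑ i, ℓ (b ω i))
          have h2 : Real.exp (-∑ i, ℓ (b ω i)) =
              Real.exp (-E) * Real.exp (E - ∑ i, ℓ (b ω i)) := by
            rw [← Real.exp_add]; congr 1; ring
          rw [h2]
          exact mul_le_mul_of_nonneg_left (by linarith) (Real.exp_pos _).le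
  have hne : (univ.image b).Nonempty := univ_nonempty.image b
  have h3 : ∑ ω, Real.exp (-∑ i, ℓ (b ω i)) < Fintype.card Ω * Real.exp (-E) := by
    calc ∑ ω, Real.exp (-∑ i, ℓ (b ω i))
        = ∑ p ∈ univ.image b, #{ω | b ω = p} * Real.exp (-∑ i, ℓ (p i)) := by
          rw [sum_comp (fun p : κ → ℤ => Real.exp (-∑ i, ℓ (p i))) b]
          simp only [nsmul_eq_mul]
      _ < ∑ p ∈ univ.image b, Fintype.card Ω * Real.exp (-E) * Real.exp (-∑ i, ℓ (p i)) :=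
          sum_lt_sum_of_nonempty hne fun p _ =>
            mul_lt_mul_of_pos_right (hlt p) (Real.exp_pos _)
      _ ≤ Fintype.card Ω * Real.exp (-E) := by
          rw [← mul_sum]
          exact mul_le_of_le_one_right hpos.le hkraft
  linarith

/-- Kraft's inequality for the two-sided geometric code with parameter `B`. -/
theorem sum_exp_neg_geometric_le_one {B : ℝ} (hB : 0 < B) (J : Finset ℤ) :
    ∑ j ∈ J, Real.exp (-(Real.log (1 + 2 * B) + Real.log (1 + 1 / B) * |(j : ℝ)|)) ≤ 1 := by
  set r : ℝ := B / (1 + B) with hr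
  have hr0 : 0 ≤ r := by positivity
  have hr1 : r < 1 := by rw [hr, div_lt_one (by positivity)]; linarith
  have hexp : ∀ j : ℤ, Real.exp (-(Real.log (1 + 2 * B) + Real.log (1 + 1 / B) * |(j : ℝ)|)) =
      (1 + 2 * B)⁻¹ * r ^ j.natAbs := by
    intro j
    have h1 : |(j : ℝ)| = (j.natAbs : ℕ) := by rw [Nat.cast_natAbs, Int.cast_abs]
    have h2 : Real.exp (-Real.log (1 + 1 / B)) = r := by
      rw [Real.exp_neg, Real.exp_log (by positivity), hr]
      field_simp
      ring
    rw [neg_add, Real.exp_add, Real.exp_neg, Real.exp_log (by positivity), h1, ← neg_mul,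
      mul_comm (-Real.log (1 + 1 / B)), Real.exp_nat_mul, h2]
  have hs : HasSum (fun j : ℤ => r ^ j.natAbs) ((1 - r)⁻¹ + r * (1 - r)⁻¹) := by
    apply HasSum.of_nat_of_neg_add_one
    · simpa using hasSum_geometric_of_lt_one hr0 hr1
    · have h := (hasSum_geometric_of_lt_one hr0 hr1).mul_left r
      have hpow : ∀ n : ℕ, r ^ (-((n : ℤ) + 1)).natAbs = r * r ^ n := by
        intro n
        rw [show (-((n : ℤ) + 1)).natAbs = n + 1 by omega, pow_succ']
      simpa only [hpow] using h
  have hval : (1 - r)⁻¹ + r * (1 - r)⁻¹ = 1 + 2 * B := by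
    have : 1 - r = (1 + B)⁻¹ := by rw [hr]; field_simp; ring
    rw [this, inv_inv, hr]; field_simp; ring
  simp_rw [hexp]
  rw [← mul_sum]
  have h1 := sum_le_hasSum J (fun j _ => pow_nonneg hr0 _) hs
  rw [hval] at h1
  rw [inv_mul_le_iff₀ (by positivity), mul_one]
  exact h1

theorem log_one_add_pow_three_le {x : ℝ} (hx : 0 ≤ x) : Real.log (1 + x ^ 3) ≤ 3 * x := by
  calc Real.log (1 + x ^ 3) ≤ Real.log ((1 + x) ^ 3) :=
        Real.log_le_log (by positivity) (by nlinarith [sq_nonneg x])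
    _ = 3 * Real.log (1 + x) := by rw [Real.log_pow]; norm_num
    _ ≤ 3 * x := by
        have := Real.log_le_sub_one_of_pos (show 0 < 1 + x by positivity)
        linarith

theorem log_one_add_pow_three_le_sq {x : ℝ} (hx : 0 ≤ x) :
    Real.log (1 + x ^ 3) ≤ 3 / 2 * x ^ 2 := by
  have h1 : Real.log ((1 + x ^ 3) ^ 2) ≤ Real.log ((1 + x ^ 2) ^ 3) := by
    apply Real.log_le_log (by positivity)
    nlinarith [sq_nonneg (x * (x - 1)), sq_nonneg x, sq_nonneg (x ^ 2)]
  rw [Real.log_pow, Real.log_pow] at h1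
  have := Real.log_le_sub_one_of_pos (show 0 < 1 + x ^ 2 by positivity)
  push_cast at h1
  linarith

/-- The mean length of the geometric code with parameter `β ^ 3`, applied to a variable of mean
absolute value at most `β ^ 3`, is `O(min β β²)`. -/
theorem geometric_code_length_le {β : ℝ} (hβ : 0 < β) :
    Real.log (1 + 2 * β ^ 3) + Real.log (1 + 1 / β ^ 3) * β ^ 3 ≤ 9 * min β (β ^ 2) := by
  have h0 : Real.log (1 + 2 * β ^ 3) ≤ Real.log (1 + (2 * β) ^ 3) := by
    apply Real.log_le_log (by positivity)
    have : 0 < β ^ 3 := by positivity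
    nlinarith
  have hi : 1 / β ^ 3 = (1 / β) ^ 3 := by field_simp
  have hb3 : 0 ≤ β ^ 3 := by positivity
  rw [hi, mul_min_of_nonneg _ _ (by norm_num : (0 : ℝ) ≤ 9), le_min_iff]
  constructor
  · have h1 := log_one_add_pow_three_le (show 0 ≤ 2 * β by positivity)
    have h2 := mul_le_mul_of_nonneg_right
      (log_one_add_pow_three_le_sq (show 0 ≤ 1 / β by positivity)) hb3
    have h3 : 3 / 2 * (1 / β) ^ 2 * β ^ 3 = 3 / 2 * β := by field_simp
    linarith
  · have h1 := log_one_add_pow_three_le_sq (show 0 ≤ 2 * β by positivity)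
    have h2 := mul_le_mul_of_nonneg_right
      (log_one_add_pow_three_le (show 0 ≤ 1 / β by positivity)) hb3
    have h3 : 3 * (1 / β) * β ^ 3 = 3 * β ^ 2 := by field_simp
    linarith

/-! ### Partial colourings -/

theorem abs_round_le (y : ℝ) : |(round y : ℝ)| ≤ 16 * y ^ 4 := by
  have hy4 : y ^ 4 = |y| ^ 4 := (Even.pow_abs (by decide) y).symm
  rcases lt_or_ge |y| (1 / 2) with h | h
  · have h0 : round y = 0 := by
      rw [round_eq_zero_iff, Set.mem_Ico]
      have := abs_lt.1 h
      constructor <;> linarith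
    rw [h0]
    simp
    positivity
  · have h1 := abs_sub_round y
    have h2 : |(round y : ℝ)| ≤ |y| + 1 / 2 := by
      have h3 := abs_sub_abs_le_abs_sub (round y : ℝ) y
      rw [abs_sub_comm] at h3
      linarith
    have h4 : 1 / 2 * (1 / 2) * (1 / 2) ≤ |y| * |y| * |y| := by gcongr
    have h5 : |y| ^ 4 = |y| * (|y| * |y| * |y|) := by ring
    rw [hy4, h5]
    nlinarith

/-- The number of points of the cube within distance `n / 20` of a point, by Chernoff's method. -/
theorem card_mul_exp_le_of_hammingDist_le {ι : Type*} [Fintype ι] [DecidableEq ι]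
    {S : Finset (ι → Bool)} {x : ι → Bool}
    (hS : ∀ y ∈ S, 20 * hammingDist x y ≤ Fintype.card ι) :
    #S * Real.exp (-(Fintype.card ι / 10)) ≤ (5 / 4) ^ Fintype.card ι := by
  have h4 : Real.exp (-2) ≤ 1 / 4 := by
    have h1 := Real.add_one_le_exp (1 : ℝ)
    have h2 : Real.exp 2 = Real.exp 1 * Real.exp 1 := by rw [← Real.exp_add]; norm_num
    rw [Real.exp_neg, inv_le_comm₀ (Real.exp_pos _) (by norm_num), h2]
    nlinarith
  calc #S * Real.exp (-(Fintype.card ι / 10))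
      = ∑ y ∈ S, Real.exp (-(Fintype.card ι / 10)) := by simp
    _ ≤ ∑ y ∈ S, Real.exp (-2 * hammingDist x y) := by
        refine sum_le_sum fun y hy => Real.exp_le_exp.2 ?_
        have : (20 * hammingDist x y : ℝ) ≤ Fintype.card ι := by exact_mod_cast hS y hy
        linarith
    _ ≤ ∑ y, Real.exp (-2 * hammingDist x y) :=
        sum_le_sum_of_subset_of_nonneg (subset_univ S) fun _ _ _ => (Real.exp_pos _).le
    _ = ∑ y : ι → Bool, ∏ j, Real.exp (-2 * if x j ≠ y j then 1 else 0) := by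
        refine sum_congr rfl fun y _ => ?_
        rw [← Real.exp_sum, ← mul_sum, sum_boole, hammingDist]
    _ = ∏ j, ∑ c : Bool, Real.exp (-2 * if x j ≠ c then 1 else 0) :=
        (Fintype.prod_sum fun j (c : Bool) => Real.exp (-2 * if x j ≠ c then 1 else 0)).symm
    _ ≤ ∏ _j : ι, (5 / 4 : ℝ) := by
        refine prod_le_prod (fun j _ => sum_nonneg fun c _ => (Real.exp_pos _).le) fun j _ => ?_
        cases x j <;> simp <;> linarith
    _ = (5 / 4) ^ Fintype.card ι := by rw [prod_const, card_univ]

/-- The partial colouring lemma: among the sign vectors `ε`, encode the rounded values of the sums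
`∑ j, ε j * v i j / D`. Few bits suffice, so some fibre is too large to lie in a small Hamming
ball, and half the difference of two distant points of it is a partial colouring. -/
theorem exists_partial_coloring {ι κ : Type*} [Fintype ι] [DecidableEq ι] [Fintype κ]
    [DecidableEq κ] (hn : 0 < Fintype.card ι) {v : κ → ι → ℝ} (hv : ∀ i j, |v i j| ≤ 1)
    {β D : ℝ} (hβ : 0 < β) (hD : 0 < D)
    (h48 : 48 * (Fintype.card ι : ℝ) ^ 2 ≤ β ^ 3 * D ^ 4)
    (hbits : Fintype.card κ * (9 * min β (β ^ 2)) ≤ Fintype.card ι / 10) :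
    ∃ χ : ι → ℝ, (∀ j, χ j = 0 ∨ χ j = 1 ∨ χ j = -1) ∧
      Fintype.card ι < 20 * #{j | χ j ≠ 0} ∧ ∀ i, |∑ j, χ j * v i j| ≤ D := by
  set n := Fintype.card ι with hndef
  set B := β ^ 3 with hB
  have hBpos : 0 < B := by positivity
  set X : (ι → Bool) → κ → ℝ := fun ε i => ∑ j, boolSign (ε j) * v i j with hX
  set b : (ι → Bool) → κ → ℤ := fun ε i => round (X ε i / D) with hb
  have hmean : ∀ i, ∑ ε, |(b ε i : ℝ)| ≤ B * 2 ^ n := by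
    intro i
    calc ∑ ε, |(b ε i : ℝ)| ≤ ∑ ε, 16 / D ^ 4 * (X ε i) ^ 4 := by
          refine sum_le_sum fun ε _ => (abs_round_le _).trans_eq ?_
          rw [div_pow]; ring
      _ ≤ 16 / D ^ 4 * (3 * n ^ 2 * 2 ^ n) := by
          rw [← mul_sum]
          exact mul_le_mul_of_nonneg_left (sum_pow_four_sum_boolSign_le (hv i) univ)
            (by positivity)
      _ = 48 * n ^ 2 / D ^ 4 * 2 ^ n := by ring
      _ ≤ B * 2 ^ n := by
          apply mul_le_mul_of_nonneg_right _ (by positivity)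
          rwa [div_le_iff₀ (by positivity)]
  set a := Real.log (1 + 2 * B)
  set l := Real.log (1 + 1 / B)
  have hl : 0 ≤ l := Real.log_nonneg (by
    have : 0 < 1 / B := by positivity
    linarith)
  have hE : ∑ ε, ∑ i, (a + l * |((b ε i : ℤ) : ℝ)|) ≤
      Fintype.card (ι → Bool) * ((n : ℝ) / 10) := by
    rw [sum_comm]
    calc ∑ i, ∑ ε, (a + l * |((b ε i : ℤ) : ℝ)|)
        ≤ ∑ _i : κ, (2 ^ n * (9 * min β (β ^ 2))) := by
          refine sum_le_sum fun i _ => ?_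
          rw [sum_add_distrib, ← mul_sum]
          have h1 := mul_le_mul_of_nonneg_left (hmean i) hl
          have h2 := mul_le_mul_of_nonneg_left (geometric_code_length_le hβ)
            (show (0 : ℝ) ≤ 2 ^ n by positivity)
          simp only [sum_const, card_univ, Fintype.card_fun, Fintype.card_bool, nsmul_eq_mul]
          push_cast
          linarith
      _ = 2 ^ n * (Fintype.card κ * (9 * min β (β ^ 2))) := by simp; ring
      _ ≤ Fintype.card (ι → Bool) * ((n : ℝ) / 10) := by
          simp only [Fintype.card_fun, Fintype.card_bool]
          push_cast
          exact mul_le_mul_of_nonneg_left hbits (by positivity)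
  obtain ⟨p, hp⟩ := exists_card_fiber_ge
    (ℓ := fun j : ℤ => a + l * |(j : ℝ)|) (sum_exp_neg_geometric_le_one hBpos) b hE
  simp only [Fintype.card_fun, Fintype.card_bool] at hp
  push_cast at hp
  -- two points of the fibre at distance more than `n / 20`
  obtain ⟨x, hx, y, hy, hxy⟩ : ∃ x, b x = p ∧ ∃ y, b y = p ∧ n < 20 * hammingDist x y := by
    have hne : 0 < #{ε | b ε = p} := by
      have : (0 : ℝ) < #{ε | b ε = p} := lt_of_lt_of_le (by positivity) hp
      exact_mod_cast this
    obtain ⟨x, hx⟩ := card_pos.1 hne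
    refine ⟨x, by simpa using hx, ?_⟩
    by_contra! hno
    have h1 := card_mul_exp_le_of_hammingDist_le (S := {ε | b ε = p}) (x := x)
      (fun y hy => hno y (by simpa using hy))
    have h2 : (2 : ℝ) ^ n * (4 / 5) ^ n ≤ (5 / 4) ^ n := by
      have h3 : (4 / 5 : ℝ) ^ n ≤ Real.exp (-(n / 10)) * Real.exp (-(n / 10)) := by
        have h4 := Real.one_sub_le_exp_neg (1 / 5 : ℝ)
        calc (4 / 5 : ℝ) ^ n ≤ Real.exp (-(1 / 5)) ^ n := by
              gcongr; linarith
          _ = Real.exp (-(n / 10)) * Real.exp (-(n / 10)) := by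
              rw [← Real.exp_nat_mul, ← Real.exp_add]; congr 1; ring
      calc (2 : ℝ) ^ n * (4 / 5) ^ n
          ≤ 2 ^ n * (Real.exp (-(n / 10)) * Real.exp (-(n / 10))) := by gcongr
        _ = 2 ^ n * Real.exp (-(n / 10)) * Real.exp (-(n / 10)) := by ring
        _ ≤ #{ε | b ε = p} * Real.exp (-(n / 10)) := by gcongr
        _ ≤ (5 / 4) ^ n := h1
    rw [← mul_pow] at h2
    have h5 : (5 / 4 : ℝ) ^ n < (2 * (4 / 5)) ^ n :=
      pow_lt_pow_left₀ (by norm_num) (by norm_num) hn.ne'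
    linarith
  refine ⟨fun j => (boolSign (x j) - boolSign (y j)) / 2, ?_, ?_, ?_⟩
  · intro j
    dsimp only
    cases x j <;> cases y j <;> norm_num [boolSign]
  · have h : #{j | (boolSign (x j) - boolSign (y j)) / 2 ≠ 0} = hammingDist x y := by
      rw [hammingDist]
      congr 1
      ext j
      simp only [mem_filter, mem_univ, true_and]
      cases x j <;> cases y j <;> norm_num [boolSign]
    rw [h]; exact hxy
  · intro i
    have hsum : ∑ j, (boolSign (x j) - boolSign (y j)) / 2 * v i j = (X x i - X y i) / 2 := by
      rw [hX, ← sum_sub_distrib, sum_div]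
      exact sum_congr rfl fun j _ => by ring
    have hr : round (X x i / D) = round (X y i / D) := congrFun (hx.trans hy.symm) i
    have h1 := abs_le.1 (abs_sub_round (X x i / D))
    have h2 := abs_le.1 (abs_sub_round (X y i / D))
    rw [hr] at h1
    have h3 : |X x i / D - X y i / D| ≤ 1 := abs_le.2 ⟨by linarith, by linarith⟩
    rw [← sub_div, abs_div, abs_of_pos hD, div_le_one hD] at h3
    rw [hsum, abs_div, abs_of_pos (by norm_num : (0 : ℝ) < 2)]
    linarith [abs_nonneg (X x i - X y i)]

/-! ### Spencer's discrepancy theorem -/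

/-- The partial colouring lemma in terms of the eighth root `w` of the ratio of variables to
constraints: the error is `O(√k)`, and decays geometrically away from `w = 1`. -/
theorem exists_partial_coloring_of_pow_eight {ι κ : Type*} [Fintype ι] [DecidableEq ι] [Fintype κ]
    [DecidableEq κ] (hκ : 0 < Fintype.card κ) {w : ℝ} (hw : 0 < w)
    (hn : (Fintype.card ι : ℝ) = w ^ 8 * Fintype.card κ) {v : κ → ι → ℝ}
    (hv : ∀ i j, |v i j| ≤ 1) :
    ∃ χ : ι → ℝ, (∀ j, χ j = 0 ∨ χ j = 1 ∨ χ j = -1) ∧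
      Fintype.card ι < 20 * #{j | χ j ≠ 0} ∧
      ∀ i, |∑ j, χ j * v i j| ≤ 80 * √(Fintype.card κ) * min w w⁻¹ := by
  have hk : (0 : ℝ) < Fintype.card κ := by exact_mod_cast hκ
  set k : ℝ := ((Fintype.card κ : ℕ) : ℝ)
  have hn0 : 0 < Fintype.card ι := by
    have : (0 : ℝ) < Fintype.card ι := by rw [hn]; positivity
    exact_mod_cast this
  have hs4 : √k ^ 4 = k ^ 2 := by
    rw [show (4 : ℕ) = 2 * 2 by norm_num, pow_mul, Real.sq_sqrt hk.le]
  rcases le_total w 1 with h | h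
  · -- few variables: the code length is quadratic in `β`
    have hmin : min w w⁻¹ = w := min_eq_left (h.trans ((one_le_inv₀ hw).2 h))
    rw [hmin]
    refine exists_partial_coloring hn0 hv (β := w ^ 4 / 10) (by positivity) (by positivity) ?_ ?_
    · rw [hn, mul_pow, mul_pow, mul_pow, hs4]
      have : 0 ≤ w ^ 16 * k ^ 2 := by positivity
      nlinarith
    · rw [hn]
      have h1 := min_le_right (w ^ 4 / 10) ((w ^ 4 / 10) ^ 2)
      have h2 := mul_le_mul_of_nonneg_left h1 (show 0 ≤ k * 9 by positivity)
      have h3 : 0 ≤ w ^ 8 * k := by positivity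
      nlinarith
  · -- many variables: the code length is linear in `β`
    have hmin : min w w⁻¹ = w⁻¹ := min_eq_right ((inv_le_one_of_one_le₀ h).trans h)
    rw [hmin]
    refine exists_partial_coloring hn0 hv (β := w ^ 8 / 90) (by positivity) (by positivity) ?_ ?_
    · rw [hn, mul_pow, mul_pow, mul_pow, hs4]
      have h1 : w ^ 16 ≤ w ^ 20 := pow_le_pow_right₀ h (by norm_num)
      have h2 : (w ^ 8 / 90) ^ 3 * (80 ^ 4 * k ^ 2 * w⁻¹ ^ 4) =
          (80 ^ 4 / 90 ^ 3) * (w ^ 20 * k ^ 2) := by field_simp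
      have h3 := mul_le_mul_of_nonneg_right h1 (show 0 ≤ k ^ 2 by positivity)
      have h4 : 0 ≤ w ^ 16 * k ^ 2 := by positivity
      rw [h2]
      nlinarith
    · rw [hn]
      have h1 := min_le_left (w ^ 8 / 90) ((w ^ 8 / 90) ^ 2)
      have h2 := mul_le_mul_of_nonneg_left h1 (show 0 ≤ k * 9 by positivity)
      linarith

/-- The potential `w / (1 + w)` drops by a constant multiple of `min w w⁻¹` when `w` shrinks by a
constant factor. -/
theorem potential_drop {w w' : ℝ} (hw : 0 < w) (hw' : 0 ≤ w') (h : w' ≤ 159 / 160 * w) :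
    w' / (1 + w') + 1 / 640 * min w w⁻¹ ≤ w / (1 + w) := by
  have h1 : w / (1 + w) - w' / (1 + w') = (w - w') / ((1 + w) * (1 + w')) := by
    field_simp; ring
  have h2 : w / 160 / ((1 + w) * (1 + w)) ≤ (w - w') / ((1 + w) * (1 + w')) := by
    apply div_le_div₀ <;> nlinarith
  have h3 : 1 / 640 * min w w⁻¹ ≤ w / 160 / ((1 + w) * (1 + w)) := by
    rw [le_div_iff₀ (by positivity)]
    rcases le_total w 1 with h | h
    · have h4 := min_le_left w w⁻¹
      have h5 : (1 + w) * (1 + w) ≤ 4 := by nlinarith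
      calc 1 / 640 * min w w⁻¹ * ((1 + w) * (1 + w)) ≤ 1 / 640 * w * 4 := by gcongr
        _ = w / 160 := by ring
    · have h4 := min_le_right w w⁻¹
      have h5 : (1 + w) * (1 + w) ≤ 4 * w ^ 2 := by nlinarith
      calc 1 / 640 * min w w⁻¹ * ((1 + w) * (1 + w)) ≤ 1 / 640 * w⁻¹ * (4 * w ^ 2) := by gcongr
        _ = w / 160 := by field_simp; ring
  linarith

/-- Iterated partial colouring; the potential of the uncoloured part bounds the discrepancy.
The constant is `80 * 640`, from the cost of one round and the drop of the potential. -/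
theorem exists_sign_abs_sum_le_potential {κ : Type*} [Fintype κ] [DecidableEq κ]
    (hκ : 0 < Fintype.card κ) (n : ℕ) :
    ∀ (ι : Type) [Fintype ι] [DecidableEq ι], Fintype.card ι = n →
      ∀ w : ℝ, 0 ≤ w → (n : ℝ) = w ^ 8 * Fintype.card κ →
      ∀ v : κ → ι → ℝ, (∀ i j, |v i j| ≤ 1) →
      ∃ x : ι → Bool, ∀ i, |∑ j, boolSign (x j) * v i j| ≤
        51200 * √(Fintype.card κ) * (w / (1 + w)) := by
  have hk : (0 : ℝ) < Fintype.card κ := by exact_mod_cast hκ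
  induction n using Nat.strong_induction_on with
  | _ n ih =>
  intro ι _ _ hcard w hw0 hw v hv
  rcases hw0.eq_or_lt with rfl | hwpos
  · have hn : n = 0 := by
      have : (n : ℝ) = 0 := by rw [hw]; simp
      exact_mod_cast this
    have : IsEmpty ι := Fintype.card_eq_zero_iff.1 (hcard.trans hn)
    exact ⟨fun _ => true, fun i => by simp⟩
  subst hcard
  obtain ⟨χ, hχ, hsupp, hdisc⟩ := exists_partial_coloring_of_pow_eight hκ hwpos hw hv
  have hsub : Fintype.card {j // χ j = 0} + #{j | χ j ≠ 0} = Fintype.card ι := by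
    rw [Fintype.card_subtype]
    exact card_filter_add_card_filter_not _
  set n' := Fintype.card {j // χ j = 0} with hn'
  obtain ⟨w', hw'0, hw'⟩ : ∃ w' : ℝ, 0 ≤ w' ∧ (n' : ℝ) = w' ^ 8 * Fintype.card κ := by
    refine ⟨((n' : ℝ) / Fintype.card κ) ^ (1 / 8 : ℝ), by positivity, ?_⟩
    rw [← Real.rpow_natCast, ← Real.rpow_mul (by positivity)]
    norm_num
    field_simp
  have hshrink : w' ≤ 159 / 160 * w := by
    apply le_of_pow_le_pow_left₀ (n := 8) (by norm_num) (by positivity)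
    have h1 : (20 * n' : ℝ) ≤ 19 * Fintype.card ι := by
      have : 20 * n' ≤ 19 * Fintype.card ι := by omega
      exact_mod_cast this
    rw [hw', hw] at h1
    have h2 : w' ^ 8 ≤ 19 / 20 * w ^ 8 := by
      have : w' ^ 8 * Fintype.card κ ≤ 19 / 20 * w ^ 8 * Fintype.card κ := by linarith
      exact le_of_mul_le_mul_right this hk
    rw [mul_pow]
    refine h2.trans (mul_le_mul_of_nonneg_right ?_ (by positivity))
    norm_num
  obtain ⟨y, hy⟩ := ih n' (by omega) {j // χ j = 0} rfl w' hw'0 hw' (fun i j => v i j)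
    (fun i j => hv i j)
  refine ⟨fun j => if h : χ j = 0 then y ⟨j, h⟩ else decide (0 < χ j), fun i => ?_⟩
  have hsplit : ∑ j, boolSign (if h : χ j = 0 then y ⟨j, h⟩ else decide (0 < χ j)) * v i j =
      ∑ j, χ j * v i j + ∑ j : {j // χ j = 0}, boolSign (y j) * v i j := by
    rw [← Fintype.sum_subtype_add_sum_subtype (fun j => χ j = 0)
      (fun j => boolSign (if h : χ j = 0 then y ⟨j, h⟩ else decide (0 < χ j)) * v i j),
      ← Fintype.sum_subtype_add_sum_subtype (fun j => χ j = 0) (fun j => χ j * v i j)]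
    have h1 : ∑ j : {j // χ j = 0}, χ j * v i j = 0 :=
      sum_eq_zero fun j _ => by rw [j.2, zero_mul]
    have h2 : ∀ j : {j // χ j = 0},
        boolSign (if h : χ j = 0 then y ⟨j, h⟩ else decide (0 < χ j)) = boolSign (y j) := by
      intro j; rw [dif_pos j.2]
    have h3 : ∀ j : {j // ¬ χ j = 0},
        boolSign (if h : χ j = 0 then y ⟨j, h⟩ else decide (0 < χ j)) = χ j := by
      intro j
      rw [dif_neg j.2]
      apply boolSign_decide_pos
      rcases (hχ j).resolve_left j.2 with h | h <;> rw [h] <;> norm_num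
    rw [h1, sum_congr rfl fun j _ => by rw [h2 j],
      sum_congr (s₁ := (univ : Finset {j // ¬ χ j = 0})) rfl fun j _ => by rw [h3 j]]
    ring
  rw [hsplit]
  have hpot := mul_le_mul_of_nonneg_left (potential_drop hwpos hw'0 hshrink)
    (show 0 ≤ 51200 * √(Fintype.card κ : ℝ) by positivity)
  have h1 := abs_add_le (∑ j, χ j * v i j) (∑ j : {j // χ j = 0}, boolSign (y j) * v i j)
  have h2 := hdisc i
  have h3 := hy i
  linarith

/-- Spencer's theorem: `k` linear forms with coefficients in `[-1, 1]`, in any number of variables,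
are simultaneously `O(√k)` at some sign vector. -/
theorem exists_sign_abs_sum_le {κ : Type*} [Fintype κ] [DecidableEq κ] {ι : Type} [Fintype ι]
    [DecidableEq ι] (v : κ → ι → ℝ) (hv : ∀ i j, |v i j| ≤ 1) :
    ∃ x : ι → Bool, ∀ i, |∑ j, boolSign (x j) * v i j| ≤ 51200 * √(Fintype.card κ) := by
  rcases Nat.eq_zero_or_pos (Fintype.card κ) with h | hκ
  · have := Fintype.card_eq_zero_iff.1 h
    exact ⟨fun _ => true, fun i => isEmptyElim i⟩
  have hk : (0 : ℝ) < Fintype.card κ := by exact_mod_cast hκ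
  set w : ℝ := ((Fintype.card ι : ℝ) / Fintype.card κ) ^ (1 / 8 : ℝ) with hw
  have hw0 : 0 ≤ w := by positivity
  have hw8 : (Fintype.card ι : ℝ) = w ^ 8 * Fintype.card κ := by
    rw [hw, ← Real.rpow_natCast, ← Real.rpow_mul (by positivity)]
    norm_num
    field_simp
  obtain ⟨x, hx⟩ := exists_sign_abs_sum_le_potential hκ _ ι rfl w hw0 hw8 v hv
  refine ⟨x, fun i => (hx i).trans (mul_le_of_le_one_right (by positivity) ?_)⟩
  rw [div_le_one (by positivity)]
  linarith

/-! ### The hitting number -/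

theorem theorem1p3 :
    ∃ c C : ℝ, 0 < c ∧ 0 < C ∧
      ∀ m t : ℕ, 0 < m → 0 < t → Even m → 4 * t ^ 2 ≤ m →
        Fintype.card (Fin m → Bool) = 2 ^ m ∧
        (farGraph m t).indepNum = ∑ i ∈ Finset.range (m / 2 - t + 1), m.choose i ∧
        c * (t : ℝ) ^ 2 ≤ (hittingNumber (farGraph m t) : ℝ) ∧
        (hittingNumber (farGraph m t) : ℝ) ≤ C * (t : ℝ) ^ 2 := by
  refine ⟨4 / 51200 ^ 2, 32, by norm_num, by norm_num, fun m t _ ht hm htm => ?_⟩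
  have htm2 : 2 * t ≤ m := by nlinarith
  have hd : 2 * (m / 2 - t) = m - 2 * t := by
    obtain ⟨q, rfl⟩ := hm
    omega
  refine ⟨by simp, indepNum_farGraph ht htm2 hd, ?_, ?_⟩
  · -- a sign vector of small discrepancy against a hitting set is far from all of it
    obtain ⟨S, hScard, hS⟩ := exists_card_eq_hittingNumber (farGraph m t)
    rw [hitsMaxIndepSets_farGraph_iff ht htm2 hd] at hS
    obtain ⟨x, hx⟩ := exists_sign_abs_sum_le (fun (s : S) j => boolSign (s.1 j))
      (fun s j => by cases s.1 j <;> simp [boolSign])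
    obtain ⟨s, hs, hsx⟩ := hS x
    have h1 := hx ⟨s, hs⟩
    rw [Fintype.card_coe, hScard] at h1
    simp only [sum_boolSign_mul, Fintype.card_fin] at h1
    have h2 : 2 * hammingDist x s + 2 * t ≤ m := by
      rw [hammingDist_comm]; omega
    have h3 : (2 * hammingDist x s + 2 * t : ℝ) ≤ m := by exact_mod_cast h2
    have h4 : (2 * t : ℝ) ≤ 51200 * √(hittingNumber (farGraph m t)) := by
      have := le_abs_self ((m : ℝ) - 2 * hammingDist x s)
      linarith
    have h5 := pow_le_pow_left₀ (by positivity) h4 2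
    rw [mul_pow, mul_pow, Real.sq_sqrt (by positivity)] at h5
    linarith
  · obtain ⟨S, hScard, hS⟩ := exists_covering_card_le ht htm
    have h1 : hittingNumber (farGraph m t) ≤ #S := by
      refine Nat.sInf_le ⟨S, rfl, ?_⟩
      rw [hitsMaxIndepSets_farGraph_iff ht htm2 hd]
      intro c
      obtain ⟨s, hs, hsc⟩ := hS c
      exact ⟨s, hs, by omega⟩
    exact_mod_cast h1.trans hScard
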